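/- A cover of an infinite set $X$ is a family $\mathcal U$ of subsets of $X$ with $X\notin\mathcal U$ and $\bigcup\mathcal U=X$. A $\tau$-cover of $X$ is a cover $\mathcal U$ such that every $x\in X$ belongs to infinitely many members of $\mathcal U$ and, for all $x,y\in X$, at least one of the sets $\{U\in\mathcal U: x\in U,\ y\notin U\}$ and $\{U\in\mathcal U: y\in U,\ x\notin U\}$ is finite. For an infinite, zero-dimensional, separable metrizable space $X$, let $\mathrm T$ and $\mathcal O$ be the collections of all countable open $\tau$-covers of $X$ and of all countable open covers of $X$, respectively. Such an $X$ satisfies $\mathsf S_1(\mathrm T,\mathcal O)$ if for every sequence $(\mathcal U_n)_{n\in\mathbb N}$ of members of $\mathrm T$ there are $U_n\in\mathcal U_n$ ($n\in\mathbb N$) with $\{U_n:n\in\mathbb N\}\in\mathcal O$. The $o$-diagonalization number $\mathfrak{od}$ is the minimal cardinality of an infinite, zero-dimensional, separable metrizable space that does not satisfy $\mathsf S_1(\mathrm T,\mathcal O)$. Let $\mathrm{cov}(\mathcal M)$ be the minimal cardinality of a family of meagre subsets of the Baire space $\mathbb N^{\mathbb N}$ whose union is $\mathbb N^{\mathbb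 N}$ (the real line in place of $\mathbb N^{\mathbb N}$ gives the same cardinal). **Theorem.** If $\mathrm{cov}(\mathcal M)=\aleph_1$, then $\mathfrak{od}=\aleph_1$. -/

import Mathlib

open Set
open scoped Cardinal

namespace ODiag

/-- `𝒰` is a cover of `X`: the whole space is not a member, and the union is everything. -/
def IsCover {X : Type*} (𝒰 : Set (Set X)) : Prop :=
  univ ∉ 𝒰 ∧ ⋃₀ 𝒰 = univ

/-- Every point belongs to infinitely many members of the cover. -/
def IsLargeCover {X : Type*} (𝒰 : Set (Set X)) : Prop :=
  IsCover 𝒰 ∧ ∀ x : X, {U ∈ 𝒰 | x ∈ U}.Infinite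

/-- A `τ`-cover: a large cover such that for all points `x`, `y`, one of the two families
`{U ∈ 𝒰 | x ∈ U, y ∉ U}`, `{U ∈ 𝒰 | y ∈ U, x ∉ U}` is finite. -/
def IsTauCover {X : Type*} (𝒰 : Set (Set X)) : Prop :=
  IsLargeCover 𝒰 ∧
    ∀ x y : X, {U ∈ 𝒰 | x ∈ U ∧ y ∉ U}.Finite ∨ {U ∈ 𝒰 | y ∈ U ∧ x ∉ U}.Finite

/-- The collection `O` of all countable open covers of `X`. -/
def openCovers (X : Type*) [TopologicalSpace X] : Set (Set (Set X)) :=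
  {𝒰 | 𝒰.Countable ∧ (∀ U ∈ 𝒰, IsOpen U) ∧ IsCover 𝒰}

/-- The collection `T` of all countable open `τ`-covers of `X`. -/
def openTauCovers (X : Type*) [TopologicalSpace X] : Set (Set (Set X)) :=
  {𝒰 | 𝒰.Countable ∧ (∀ U ∈ 𝒰, IsOpen U) ∧ IsTauCover 𝒰}

/-- The selection hypothesis `S₁(𝒜, ℬ)`: from each sequence of members of `𝒜` one can select
one element each so that the selected elements form a member of `ℬ`. -/
def SOne {X : Type*} (𝒜 ℬ : Set (Set (Set X))) : Prop :=
  ∀ 𝒰 : ℕ → Set (Set X), (∀ n, 𝒰 n ∈ 𝒜) →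
    ∃ U : ℕ → Set X, (∀ n, U n ∈ 𝒰 n) ∧ range U ∈ ℬ

/-- The spaces under consideration ("sets of reals"): infinite, zero-dimensional (the clopen
sets form a base), separable, metrizable. -/
structure IsSetOfReals (X : Type*) [TopologicalSpace X] : Prop where
  infinite : Infinite X
  zeroDimensional : TopologicalSpace.IsTopologicalBasis {s : Set X | IsClopen s}
  separable : TopologicalSpace.SeparableSpace X
  metrizable : TopologicalSpace.MetrizableSpace X

/-- The critical cardinality `non(P)`: the minimal cardinality of a set of reals that does not
satisfy `P`. -/
noncomputable def non (P : (X : Type) → [TopologicalSpace X] → Prop) : Cardinal.{0} :=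
  sInf {κ | ∃ (X : Type) (_ : TopologicalSpace X), IsSetOfReals X ∧ ¬ P X ∧ #X = κ}

/-- The `o`-diagonalization number `𝔬𝔡 = non(S₁(T, O))`. -/
noncomputable def od : Cardinal.{0} :=
  non fun X _ => SOne (openTauCovers X) (openCovers X)

/-- `cov(ℳ)`: the minimal cardinality of a family of meagre subsets of the Baire space that
covers the Baire space. -/
noncomputable def covM : Cardinal.{0} :=
  sInf {κ | ∃ F : Set (Set (ℕ → ℕ)), (∀ M ∈ F, IsMeagre M) ∧ ⋃₀ F = univ ∧ #F = κ}

end ODiag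

namespace ODiag

open Filter

/-! ### Countable spaces and the lower bound -/

/-! Countable spaces satisfy the selection principle, so only a counterexample of size at most ℵ₁ is
needed. By `not_sOne_flipSet` it suffices to find ℵ₁ many sequences of infinite sets, comparable
modulo finite in each coordinate, such that no single sequence of points meets them all. If 𝔡 = ℵ₁,
final segments above a dominating family work. If 𝔡 > ℵ₁, a Bartoszyński-style argument turns cov(ℳ)
= ℵ₁ into ℵ₁ many functions such that every function differs everywhere from one of them
(`exists_eventuallyDifferent`). Square arrays having a given function as a row form centred
families, which ℵ₁ < 𝔡 refines to towers (`exists_tower`); the diagonal of a selected array defeats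
any selection. -/

theorem sOne_openTauCovers_openCovers_of_countable {X : Type*} [TopologicalSpace X] [Nonempty X]
    [Countable X] : SOne (openTauCovers X) (openCovers X) := by
  intro 𝒰 h𝒰
  obtain ⟨e, he⟩ := exists_surjective_nat X
  have hex : ∀ n, ∃ U ∈ 𝒰 n, e n ∈ U := fun n => by
    have h : e n ∈ ⋃₀ 𝒰 n := by rw [(h𝒰 n).2.2.1.1.2]; trivial
    simpa using h
  choose U hU heU using hex
  refine ⟨U, hU, countable_range U, ?_, ?_, ?_⟩
  · rintro _ ⟨n, rfl⟩
    exact (h𝒰 n).2.1 _ (hU n)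
  · rintro ⟨n, hn⟩
    exact (h𝒰 n).2.2.1.1.1 (hn ▸ hU n)
  · refine eq_univ_of_forall fun x => ?_
    obtain ⟨n, rfl⟩ := he x
    exact ⟨U n, mem_range_self n, heU n⟩

/-! ### Spaces from families of sets that are linearly ordered modulo finite sets -/

/-- `S` is a family of sequences of infinite sets, linearly ordered modulo finite sets in each
coordinate, such that every sequence of points avoids a member of the family. -/
structure IsUndiagonalizable {T C : Type*} (S : T → ℕ → Set C) : Prop where
  infinite : ∀ i n, (S i n).Infinite
  comparable : ∀ i j n, (S i n \ S j n).Finite ∨ (S j n \ S i n).Finite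
  avoid : ∀ c : ℕ → C, ∃ i, ∀ n, c n ∉ S i n

theorem isTopologicalBasis_isClopen_subtype {Y : Type*} [TopologicalSpace Y] [CompactSpace Y]
    [T2Space Y] [TotallyDisconnectedSpace Y] (A : Set Y) :
    TopologicalSpace.IsTopologicalBasis {s : Set A | IsClopen s} := by
  refine TopologicalSpace.isTopologicalBasis_of_isOpen_of_nhds (fun s hs => hs.isOpen) ?_
  intro a u ha hu
  obtain ⟨v, hv, rfl⟩ := isOpen_induced_iff.1 hu
  obtain ⟨w, hw, haw, hwv⟩ := compact_exists_isClopen_in_isOpen hv ha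
  exact ⟨_, hw.preimage continuous_subtype_val, haw, preimage_mono hwv⟩

open Classical in
/-- The indicator of the sequence `S` of sets, modified on the finite set `F`. -/
noncomputable def flipIndicator {C : Type*} (S : ℕ → Set C) (F : Finset (ℕ × C)) : ℕ × C → Bool :=
  fun p => xor (decide (p.2 ∈ S p.1)) (decide (p ∈ F))

theorem flipIndicator_of_notMem {C : Type*} {S : ℕ → Set C} {F : Finset (ℕ × C)} {p : ℕ × C}
    (hp : p ∉ F) : flipIndicator S F p = true ↔ p.2 ∈ S p.1 := by
  simp [flipIndicator, hp]

theorem exists_flipIndicator_eq {C : Type*} (S : ℕ → Set C) (v : ℕ × C → Bool)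
    (F : Finset (ℕ × C)) : ∃ G, ∀ p ∈ F, flipIndicator S G p = v p := by
  classical
  refine ⟨F.filter fun p => decide (p.2 ∈ S p.1) ≠ v p, fun p hp => ?_⟩
  by_cases h : p.2 ∈ S p.1 <;> cases hv : v p <;> simp [flipIndicator, h, hp, hv]

theorem finite_snd_fiber {C : Type*} (F : Finset (ℕ × C)) (n : ℕ) : {c | (n, c) ∈ F}.Finite :=
  F.finite_toSet.preimage (Prod.mk_right_injective n).injOn

section Space

variable {T C : Type} {S : T → ℕ → Set C}

/-- The set of all finite modifications of the indicators of the members of `S`. -/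
def flipSet (S : T → ℕ → Set C) : Set (ℕ × C → Bool) :=
  range fun q : T × Finset (ℕ × C) => flipIndicator (S q.1) q.2

/-- The open subsets of `flipSet S` given by the coordinates in column `n`. -/
def flipCover (S : T → ℕ → Set C) (n : ℕ) (c : C) : Set (flipSet S) :=
  {x | x.1 (n, c) = true}

/-- Density of `flipSet S` in the Cantor cube is the purpose of the finite modifications: it makes
the cover members distinct and proper, and the space infinite. -/
theorem exists_flipSet_eq [Nonempty T] (v : ℕ × C → Bool) (F : Finset (ℕ × C)) :
    ∃ x : flipSet S, ∀ p ∈ F, x.1 p = v p := by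
  obtain ⟨i⟩ := ‹Nonempty T›
  obtain ⟨G, hG⟩ := exists_flipIndicator_eq (S i) v F
  exact ⟨⟨_, (i, G), rfl⟩, hG⟩

theorem flipCover_injective [Nonempty T] (n : ℕ) : Function.Injective (flipCover S n) := by
  classical
  intro c d h
  by_contra hne
  obtain ⟨x, hx⟩ := exists_flipSet_eq (S := S) (fun p => decide (p = (n, c))) {(n, c), (n, d)}
  have hc : x ∈ flipCover S n c := by
    have := hx (n, c) (by simp)
    simpa [flipCover] using this
  rw [h] at hc
  have hd := hx (n, d) (by simp)
  have hdc : ¬ d = c := fun h => hne h.symm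
  simp [flipCover, hd, hdc] at hc

theorem flipCover_mem_openTauCovers [Nonempty T] [Countable C] (hS : IsUndiagonalizable S) (n : ℕ) :
    range (flipCover S n) ∈ openTauCovers (flipSet S) := by
  have hlarge : ∀ x : flipSet S, {U ∈ range (flipCover S n) | x ∈ U}.Infinite := by
    rintro ⟨_, ⟨i, F⟩, rfl⟩
    have h := ((hS.infinite i n).sdiff (finite_snd_fiber F n)).image
      (flipCover_injective (S := S) n).injOn
    refine h.mono ?_
    rintro _ ⟨c, ⟨hc, hcF⟩, rfl⟩
    exact ⟨mem_range_self c, (flipIndicator_of_notMem hcF).2 hc⟩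
  have hfin : ∀ (i j : T) (F G : Finset (ℕ × C)) (hi hj), (S i n \ S j n).Finite →
      {U ∈ range (flipCover S n) | (⟨flipIndicator (S i) F, hi⟩ : flipSet S) ∈ U ∧
        (⟨flipIndicator (S j) G, hj⟩ : flipSet S) ∉ U}.Finite := by
    intro i j F G hi hj h
    refine (((h.union (finite_snd_fiber F n)).union (finite_snd_fiber G n)).image
      (flipCover S n)).subset ?_
    rintro _ ⟨⟨c, rfl⟩, hci, hcj⟩
    refine ⟨c, ?_, rfl⟩
    by_cases hF : (n, c) ∈ F
    · exact Or.inl (Or.inr hF)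
    by_cases hG : (n, c) ∈ G
    · exact Or.inr hG
    exact Or.inl (Or.inl ⟨(flipIndicator_of_notMem hF).1 hci,
      fun h => hcj ((flipIndicator_of_notMem hG).2 h)⟩)
  refine ⟨countable_range _, ?_, ⟨⟨⟨?_, ?_⟩, hlarge⟩, ?_⟩⟩
  · rintro _ ⟨c, rfl⟩
    have hcont : Continuous fun x : flipSet S => x.1 (n, c) :=
      (continuous_apply _).comp continuous_subtype_val
    exact (isOpen_discrete {true}).preimage hcont
  · rintro ⟨c, hc⟩
    obtain ⟨x, hx⟩ := exists_flipSet_eq (S := S) (fun _ => false) {(n, c)}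
    have : x ∈ flipCover S n c := hc ▸ mem_univ x
    simp [flipCover, hx] at this
  · refine eq_univ_of_forall fun x => ?_
    obtain ⟨U, hU, hx⟩ := (hlarge x).nonempty
    exact ⟨U, hU, hx⟩
  · rintro ⟨_, ⟨i, F⟩, rfl⟩ ⟨_, ⟨j, G⟩, rfl⟩
    exact (hS.comparable i j n).imp (hfin i j F G _ _) (hfin j i G F _ _)

theorem not_sOne_flipSet [Nonempty T] [Countable C] (hS : IsUndiagonalizable S) :
    ¬ SOne (openTauCovers (flipSet S)) (openCovers (flipSet S)) := by
  intro h
  obtain ⟨U, hU, hcover⟩ := h _ (flipCover_mem_openTauCovers hS)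
  choose c hc using hU
  obtain ⟨i, hi⟩ := hS.avoid c
  have hx : (⟨_, (i, ∅), rfl⟩ : flipSet S) ∈ ⋃₀ range U := by
    rw [hcover.2.2.2]; trivial
  obtain ⟨_, ⟨n, rfl⟩, hn⟩ := hx
  rw [← hc n] at hn
  exact hi n ((flipIndicator_of_notMem (by simp)).1 hn)

theorem isSetOfReals_flipSet [Nonempty T] [Countable C] [Nonempty C] :
    IsSetOfReals (flipSet S) where
  infinite := by
    classical
    obtain ⟨c⟩ := ‹Nonempty C›
    have h : ∀ k : ℕ, ∃ x : flipSet S, ∀ p ∈ (Finset.range (k + 1)).image (fun n => (n, c)),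
        x.1 p = decide (p.1 = k) := fun k => exists_flipSet_eq (fun p => decide (p.1 = k)) _
    choose x hx using h
    have key : ∀ k l, k < l → x k ≠ x l := by
      intro k l hkl he
      have h1 := hx k (k, c) (by simp)
      have h2 := hx l (k, c) (by simp; omega)
      rw [he, h2] at h1
      simp [hkl.ne] at h1
    refine Infinite.of_injective x fun k l he => ?_
    rcases lt_trichotomy k l with h | h | h
    · exact absurd he (key k l h)
    · exact h
    · exact absurd he.symm (key l k h)
  zeroDimensional := isTopologicalBasis_isClopen_subtype _
  separable := inferInstance
  metrizable := inferInstance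

theorem mk_flipSet_le [Countable C] (hT : #T ≤ ℵ₁) : #(flipSet S) ≤ ℵ₁ := by
  refine Cardinal.mk_range_le.trans ?_
  rw [Cardinal.mk_prod, Cardinal.lift_id, Cardinal.lift_id]
  exact Cardinal.mul_le_of_le (Cardinal.aleph0_le_aleph 1) hT
    (Cardinal.mk_le_aleph0.trans (Cardinal.aleph0_le_aleph 1))

theorem od_eq_aleph_one_of_isUndiagonalizable [Countable C] [Nonempty C] (hT : #T ≤ ℵ₁)
    (hS : IsUndiagonalizable S) : od = ℵ₁ := by
  have hT' : Nonempty T := ⟨(hS.avoid fun _ => Classical.arbitrary C).choose⟩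
  have hmem : #(flipSet S) ∈ {κ | ∃ (X : Type) (_ : TopologicalSpace X), IsSetOfReals X ∧
      ¬ SOne (openTauCovers X) (openCovers X) ∧ #X = κ} :=
    ⟨_, _, isSetOfReals_flipSet, not_sOne_flipSet hS, rfl⟩
  refine le_antisymm ((csInf_le' hmem).trans (mk_flipSet_le hT)) (le_csInf ⟨_, hmem⟩ ?_)
  rintro _ ⟨X, _, hX, hX', rfl⟩
  by_contra hlt
  have : Countable X := by
    rw [← Cardinal.mk_le_aleph0_iff, ← Order.lt_succ_iff, Cardinal.succ_aleph0]
    exact not_le.1 hlt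
  have := hX.infinite
  exact hX' sOne_openTauCovers_openCovers_of_countable

end Space

/-! ### Dominating families -/

/-- No family of at most `ℵ₁` functions is dominating: the dominating number exceeds `ℵ₁`. -/
def AlephOneLtDominating : Prop :=
  ∀ (T : Type) (_ : #T ≤ ℵ₁) (u : T → ℕ → ℕ), ∃ r : ℕ → ℕ, ∀ i, ∃ᶠ n in atTop, u i n ≤ r n

theorem od_eq_aleph_one_of_dominating (h : ¬ AlephOneLtDominating) : od = ℵ₁ := by
  simp only [AlephOneLtDominating, not_forall, not_exists, not_frequently, not_le] at h
  obtain ⟨T, hT, u, hu⟩ := h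
  have hTN : #(T × ℕ) ≤ ℵ₁ := by
    rw [Cardinal.mk_prod, Cardinal.lift_id, Cardinal.lift_id]
    exact Cardinal.mul_le_of_le (Cardinal.aleph0_le_aleph 1) hT
      (Cardinal.mk_le_aleph0.trans (Cardinal.aleph0_le_aleph 1))
  refine od_eq_aleph_one_of_isUndiagonalizable (C := ℕ)
    (S := fun (q : T × ℕ) n => {m | u q.1 n + q.2 ≤ m}) hTN ⟨?_, ?_, ?_⟩
  · exact fun q n => Ici_infinite _
  · intro q q' n
    refine Or.inl ((finite_lt_nat (u q'.1 n + q'.2)).subset ?_)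
    rintro m ⟨-, hm⟩
    simpa using hm
  · intro c
    obtain ⟨i, hi⟩ := hu c
    obtain ⟨N, hN⟩ := eventually_atTop.1 hi
    -- The shift exceeds the finitely many values of `c` below `N`, upgrading eventual domination to
    -- domination everywhere.
    refine ⟨(i, ∑ n ∈ Finset.range N, c n + 1), fun n hn => ?_⟩
    change c n ∈ {m | u i n + (∑ n ∈ Finset.range N, c n + 1) ≤ m} at hn
    rw [mem_ofPred_eq] at hn
    rcases lt_or_ge n N with h | h
    · have := Finset.single_le_sum (f := c) (fun _ _ => Nat.zero_le _) (Finset.mem_range.2 h)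
      omega
    · have := hN n h
      omega

/-! ### Refining centred families to towers -/

section Tower

variable {ι C : Type}

/-- `P` has infinite intersection with each finite intersection of members of `B`. -/
def IsPositive (B : ι → Set C) (P : Set C) : Prop :=
  ∀ t : Finset ι, (P ∩ ⋂ i ∈ t, B i).Infinite

theorem IsPositive.mono_finite {B : ι → Set C} {P Q : Set C} (hP : IsPositive B P)
    (h : (P \ Q).Finite) : IsPositive B Q := by
  intro t
  refine ((hP t).sdiff h).mono ?_
  rintro c ⟨⟨hcP, hct⟩, hc⟩
  exact ⟨by_contra fun hcQ => hc ⟨hcP, hcQ⟩, hct⟩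

theorem IsPositive.inter {B : ι → Set C} {P : Set C} (hP : IsPositive B P) (j : ι) :
    IsPositive B (P ∩ B j) := by
  classical
  intro t
  refine (hP (insert j t)).mono ?_
  rintro c ⟨hcP, hc⟩
  rw [Finset.set_biInter_insert] at hc
  exact ⟨⟨hcP, hc.1⟩, hc.2⟩

theorem IsPositive.exists_pseudoIntersection [Countable C] (hd : AlephOneLtDominating)
    (hι : #ι ≤ ℵ₁) {B : ι → Set C} {P : ℕ → Set C} (hP : ∀ k, IsPositive B (P k))
    (hanti : Antitone P) : ∃ Q, IsPositive B Q ∧ ∀ k, (Q \ P k).Finite := by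
  obtain ⟨f, hf⟩ := exists_injective_nat C
  have hfin : #(Finset ι) ≤ ℵ₁ := by
    rcases finite_or_infinite ι with h | h
    · exact Cardinal.mk_le_aleph0.trans (Cardinal.aleph0_le_aleph 1)
    · rwa [Cardinal.mk_finset_of_infinite]
  have hex : ∀ (t : Finset ι) (k : ℕ), ∃ c ∈ P k ∩ ⋂ i ∈ t, B i, k ≤ f c := by
    intro t k
    by_contra! hlt
    exact hP k t (((finite_lt_nat k).preimage hf.injOn).subset fun c hc => hlt c hc)
  choose c hc hkc using hex
  obtain ⟨r, hr⟩ := hd (Finset ι) hfin fun t k => f (c t k)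
  -- Each slice is finite, so only the slices before `k` leave `P k`. As `r` is infinitely often
  -- above the codes of the witnesses for `t`, witnesses of unbounded code are captured.
  refine ⟨⋃ k, P k ∩ {x | f x ≤ r k}, fun t hfinite => ?_, fun k => ?_⟩
  · obtain ⟨N, hN⟩ := (hfinite.image f).bddAbove
    obtain ⟨k, hk, hrk⟩ := (frequently_atTop.1 (hr t)) (N + 1)
    have := hN ⟨c t k, ⟨mem_iUnion.2 ⟨k, (hc t k).1, hrk⟩, (hc t k).2⟩, rfl⟩
    have := hkc t k
    omega
  · refine ((finite_lt_nat k).biUnion fun l _ =>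
      (finite_le_nat (r l)).preimage hf.injOn).subset ?_
    rintro x ⟨hx, hxk⟩
    obtain ⟨l, hxl, hle⟩ := mem_iUnion.1 hx
    refine mem_biUnion (x := l) ?_ hle
    by_contra hl
    exact hxk (hanti (not_lt.1 hl) hxl)

theorem IsPositive.exists_next [LinearOrder ι] [Countable C] (hd : AlephOneLtDominating)
    (hι : #ι ≤ ℵ₁) {B : ι → Set C} (hB : IsPositive B univ) (j : ι) (hj : (Iio j).Countable)
    (S : ι → Set C) (hS : ∀ i < j, IsPositive B (S i))
    (hSS : ∀ i < j, ∀ i' < i, (S i \ S i').Finite) :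
    ∃ Q, IsPositive B Q ∧ Q ⊆ B j ∧ ∀ i < j, (Q \ S i).Finite := by
  rcases (Iio j).eq_empty_or_nonempty with h0 | hne
  · refine ⟨univ ∩ B j, hB.inter j, inter_subset_right, fun i hi => ?_⟩
    exact absurd (show i ∈ Iio j from hi) (by simp [h0])
  obtain ⟨e, he⟩ := hj.exists_eq_range hne
  have hej : ∀ k, e k < j := fun k => show e k ∈ Iio j by rw [he]; exact mem_range_self k
  have hpos : ∀ k, IsPositive B (⋂ l ∈ Finset.range (k + 1), S (e l)) := by
    intro k
    -- The set of largest index is almost contained in the others, so the finite intersection stays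
    -- positive.
    obtain ⟨m, -, hm⟩ := Finset.exists_max_image (Finset.range (k + 1)) e ⟨0, by simp⟩
    refine (hS (e m) (hej m)).mono_finite ?_
    rw [show S (e m) \ ⋂ l ∈ Finset.range (k + 1), S (e l) =
        ⋃ l ∈ Finset.range (k + 1), S (e m) \ S (e l) by simp only [sdiff_iInter]]
    refine (Finset.finite_toSet _).biUnion fun l hl => ?_
    rcases (hm l hl).eq_or_lt with h | h
    · simp [h]
    · exact hSS _ (hej m) _ h
  obtain ⟨Q, hQ, hQS⟩ := IsPositive.exists_pseudoIntersection hd hι hpos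
    (fun k l hkl => biInter_subset_biInter_left fun m hm => by
      simp only [Finset.coe_range, mem_Iio] at hm ⊢; omega)
  refine ⟨Q ∩ B j, hQ.inter j, inter_subset_right, fun i hi => ?_⟩
  obtain ⟨k, rfl⟩ : i ∈ range e := he ▸ hi
  refine (hQS k).subset (sdiff_subset_sdiff inter_subset_left ?_)
  exact biInter_subset_of_mem (by simp)

theorem exists_tower [LinearOrder ι] [WellFoundedLT ι] [Countable C]
    (hd : AlephOneLtDominating) (hι : #ι ≤ ℵ₁) (hcount : ∀ j : ι, (Iio j).Countable)
    {B : ι → Set C} (hB : IsPositive B univ) :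
    ∃ S : ι → Set C, (∀ i, (S i).Infinite) ∧ (∀ i, S i ⊆ B i) ∧
      ∀ i j, i < j → (S j \ S i).Finite := by
  classical
  let good (j : ι) (prev : ∀ i, i < j → Set C) (Q : Set C) : Prop :=
    IsPositive B Q ∧ Q ⊆ B j ∧ ∀ i (hi : i < j), (Q \ prev i hi).Finite
  let S : ι → Set C := (wellFounded_lt (α := ι)).fix fun j prev =>
    if h : ∃ Q, good j prev Q then h.choose else ∅
  have hS : ∀ j, S j = if h : ∃ Q, good j (fun i _ => S i) Q then h.choose else ∅ :=
    fun j => WellFounded.fix_eq _ _ _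
  have hgood : ∀ j, good j (fun i _ => S i) (S j) := by
    intro j
    induction j using WellFoundedLT.induction with
    | ind j ih =>
      have hex : ∃ Q, good j (fun i _ => S i) Q :=
        IsPositive.exists_next hd hι hB j (hcount j) S (fun i hi => (ih i hi).1)
          fun i hi i' hi' => (ih i hi).2.2 i' hi'
      have h := hS j
      rw [dif_pos hex] at h
      rw [h]
      exact hex.choose_spec
  exact ⟨S, fun i => by simpa using (hgood i).1 ∅, fun i => (hgood i).2.1,
    fun i j hij => (hgood j).2.2 i hij⟩

end Tower

/-! ### From eventually different families to towers -/

/-- The square arrays of size `p.1` one of whose rows is `f n p.1`. -/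
def rowSet (f : ℕ → ℕ → ℕ → ℕ) (n : ℕ) : Set (Σ k : ℕ, Fin k → Fin k → ℕ) :=
  {p | ∃ j, p.2 j = fun i : Fin p.1 => f n p.1 i}

theorem isPositive_rowSet {ι : Type} (f : ι → ℕ → ℕ → ℕ → ℕ) (n : ℕ) :
    IsPositive (fun i => rowSet (f i) n) univ := by
  classical
  intro t
  rw [univ_inter]
  -- An array of size at least `t.card` has room for every function indexed by `t` as a row.
  let s (k : ℕ) : Fin k → Fin k → ℕ := fun j l =>
    if h : (j : ℕ) < t.card then f (t.equivFin.symm ⟨j, h⟩) n k l else 0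
  refine ((Ici_infinite t.card).image (f := fun k => (⟨k, s k⟩ : Σ k : ℕ, Fin k → Fin k → ℕ))
    fun k _ l _ h => (Sigma.mk.inj h).1).mono ?_
  rintro _ ⟨k, hk, rfl⟩
  refine mem_iInter₂.2 fun i hi => ?_
  refine ⟨⟨t.equivFin ⟨i, hi⟩, (t.equivFin ⟨i, hi⟩).2.trans_le hk⟩, ?_⟩
  funext l
  simp [s]

theorem od_eq_aleph_one_of_eventuallyDifferent {ι : Type} [LinearOrder ι] [WellFoundedLT ι]
    (hd : AlephOneLtDominating) (hι : #ι ≤ ℵ₁) (hcount : ∀ j : ι, (Iio j).Countable)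
    (f : ι → ℕ → ℕ → ℕ → ℕ) (hf : ∀ g : ℕ → ℕ → ℕ → ℕ, ∃ i, ∀ n k l, f i n k l ≠ g n k l) :
    od = ℵ₁ := by
  choose S hinf hsub hS using fun n => exists_tower hd hι hcount (isPositive_rowSet f n)
  have : Nonempty (Σ k : ℕ, Fin k → Fin k → ℕ) := ⟨⟨0, fun _ _ => 0⟩⟩
  refine od_eq_aleph_one_of_isUndiagonalizable (S := fun i n => S n i) hι
    ⟨fun i n => hinf n i, fun i j n => ?_, fun c => ?_⟩
  · rcases lt_trichotomy i j with h | rfl | h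
    · exact Or.inr (hS n i j h)
    · simp
    · exact Or.inl (hS n j i h)
  -- Diagonal of the selected array: if row `j` were the function of index `i`, they would agree at
  -- `j`.
  · obtain ⟨i, hi⟩ := hf fun n k l => if h : l < (c n).1 then (c n).2 ⟨l, h⟩ ⟨l, h⟩ else 0
    refine ⟨i, fun n hn => ?_⟩
    obtain ⟨j, hj⟩ := hsub n i hn
    refine hi n (c n).1 j ?_
    rw [dif_pos j.2, hj]

/-! ### Eventually different families from coverings by nowhere dense sets -/

/-- Each closed nowhere dense set is avoided by a finite block that works for all initial segments
of length `R` with values at most `R`. -/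
theorem exists_avoiding_block {M : Set (ℕ → ℕ)} (hM : IsClosed M) (hM' : IsNowhereDense M)
    (R : ℕ) : ∃ (N : ℕ) (s : ℕ →₀ ℕ), R ≤ N ∧ (∀ k, s k ≤ N) ∧
      ∀ x : ℕ → ℕ, (∀ k < R, x k ≤ R) → (∀ k, R ≤ k → k < N → x k = s k) → x ∉ M := by
  classical
  have hdense : Dense Mᶜ := by
    rw [← interior_eq_empty_iff_dense_compl]
    simpa [IsNowhereDense, hM.closure_eq] using hM'
  -- Only finitely many initial segments occur; the block is lengthened once for each.
  have key : ∀ T : Finset (Fin R → Fin (R + 1)), ∃ (N : ℕ) (s : ℕ → ℕ), R ≤ N ∧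
      ∀ t ∈ T, ∀ x : ℕ → ℕ, (∀ k (hk : k < R), x k = t ⟨k, hk⟩) →
        (∀ k, R ≤ k → k < N → x k = s k) → x ∉ M := by
    intro T
    induction T using Finset.induction_on with
    | empty => exact ⟨R, 0, le_rfl, by simp⟩
    | insert t T _ ih =>
      obtain ⟨N, s, hRN, hs⟩ := ih
      let z : ℕ → ℕ := fun k => if hk : k < R then t ⟨k, hk⟩ else s k
      obtain ⟨z', hz', hz'M⟩ := hdense.inter_open_nonempty _ (PiNat.isOpen_cylinder (fun _ => ℕ) z N)
        ⟨z, PiNat.self_mem_cylinder z N⟩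
      obtain ⟨N', hN'⟩ : ∃ N', PiNat.cylinder z' N' ⊆ Mᶜ := by
        obtain ⟨_, ⟨w, N', rfl⟩, hw, hsub⟩ :=
          (PiNat.isTopologicalBasis_cylinders (fun _ : ℕ => ℕ)).exists_subset_of_mem_open hz'M
            hM.isOpen_compl
        rw [PiNat.mem_cylinder_iff_eq] at hw
        exact ⟨N', hw ▸ hsub⟩
      refine ⟨max N N', z', hRN.trans (le_max_left _ _), fun t' ht' x hx hxs => ?_⟩
      rcases Finset.mem_insert.1 ht' with rfl | ht'
      · refine hN' fun k hk => ?_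
        rcases lt_or_ge k R with hkR | hkR
        · rw [hx k hkR, hz' k (hkR.trans_le hRN)]
          simp [z, hkR]
        · exact hxs k hkR (lt_max_of_lt_right hk)
      · refine hs t' ht' x hx fun k hkR hkN => ?_
        rw [hxs k hkR (lt_max_of_lt_left hkN), hz' k hkN]
        simp [z, not_lt.2 hkR]
  obtain ⟨N, s, hRN, hs⟩ := key Finset.univ
  let s' : ℕ →₀ ℕ := Finsupp.indicator (Finset.range N) fun k _ => s k
  have hs' : ∀ k < N, s' k = s k := fun k hk =>
    Finsupp.indicator_of_mem (Finset.mem_range.2 hk) _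
  refine ⟨max N (∑ k ∈ Finset.range N, s k), s', hRN.trans (le_max_left _ _),
    fun k => ?_, fun x hx hxs => ?_⟩
  · by_cases hk : k < N
    · rw [hs' k hk]
      exact le_max_of_le_right
        (Finset.single_le_sum (fun _ _ => Nat.zero_le _) (Finset.mem_range.2 hk))
    · rw [show s' k = 0 from Finsupp.indicator_of_notMem (by simpa using hk) _]
      exact Nat.zero_le _
  · refine hs (fun k => ⟨x k, Nat.lt_succ_of_le (hx k k.2)⟩) (Finset.mem_univ _) x
      (fun k hk => rfl) fun k hkR hkN => ?_
    rw [hxs k hkR (lt_max_of_lt_left hkN), hs' k hkN]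

theorem _root_.StrictMono.exists_mem_Ico_succ {r : ℕ → ℕ} (hr : StrictMono r) (hr0 : r 0 = 0)
    (m : ℕ) : ∃ n, r n ≤ m ∧ m < r (n + 1) := by
  induction m with
  | zero => exact ⟨0, hr0.le, hr0.symm.trans_lt (hr (Nat.lt_succ_self 0))⟩
  | succ m ih =>
    obtain ⟨n, hn, hn'⟩ := ih
    rcases (Nat.succ_le_of_lt hn').lt_or_eq with h | h
    · exact ⟨n, hn.trans (Nat.le_succ m), h⟩
    · exact ⟨n + 1, h.ge, h.trans_lt (hr (Nat.lt_succ_self _))⟩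

/-- If `ℵ₁ < 𝔡`, then `ℵ₁` many functions admit one sequence whose intervals are infinitely often
long with respect to each of them. -/
theorem AlephOneLtDominating.exists_strictMono (hd : AlephOneLtDominating) {ι : Type}
    (hι : #ι ≤ ℵ₁) (h : ι → ℕ → ℕ) : ∃ r : ℕ → ℕ, StrictMono r ∧ r 0 = 0 ∧
      ∀ i, {n | h i (r n) ≤ r (n + 1)}.Infinite := by
  let H (i : ι) (m : ℕ) : ℕ := ∑ k ∈ Finset.range (m + 1), h i k
  have hH : ∀ i, Monotone (H i) := fun i a b hab =>
    Finset.sum_le_sum_of_subset (Finset.range_mono (by omega))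
  have hhH : ∀ i m, h i m ≤ H i m := fun i m =>
    Finset.single_le_sum (f := h i) (fun _ _ => Nat.zero_le _) (Finset.self_mem_range_succ m)
  -- The double iterate handles `m` in `[r n, r (n + 1))`: either `H i m ≤ r (n + 1)` and this
  -- interval is long, or `r (n + 1) < H i m` and the next one is.
  obtain ⟨q, hq⟩ := hd ι hι fun i m => H i (H i m)
  let Q (m : ℕ) : ℕ := ∑ k ∈ Finset.range (m + 1), q k + m + 1
  have hQ : Monotone Q := fun a b hab => by
    have : ∑ k ∈ Finset.range (a + 1), q k ≤ ∑ k ∈ Finset.range (b + 1), q k :=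
      Finset.sum_le_sum_of_subset (Finset.range_mono (by omega))
    simp only [Q]; omega
  have hqQ : ∀ m, q m ≤ Q m := fun m => by
    have := Finset.single_le_sum (f := q) (fun _ _ => Nat.zero_le _)
      (Finset.self_mem_range_succ m)
    simp only [Q]; omega
  let r (n : ℕ) : ℕ := Q^[n] 0
  have hr1 : ∀ n, r (n + 1) = Q (r n) := fun n => Function.iterate_succ_apply' _ _ _
  have hr : StrictMono r := strictMono_nat_of_lt_succ fun n => by
    rw [hr1]; simp only [Q]; omega
  refine ⟨r, hr, rfl, fun i => infinite_of_not_bddAbove ?_⟩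
  rintro ⟨N, hN⟩
  obtain ⟨m, hm, hqm⟩ := frequently_atTop.1 (hq i) (r (N + 1))
  obtain ⟨n, hn, hn'⟩ := hr.exists_mem_Ico_succ rfl m
  have hNn : N < n := by
    have := hr.lt_iff_lt.1 (hm.trans_lt hn')
    omega
  by_cases hc : H i m ≤ r (n + 1)
  · exact absurd (hN (((hhH i _).trans (hH i hn)).trans hc)) (not_le.2 hNn)
  · have hle : h i (r (n + 1)) ≤ r (n + 1 + 1) := by
      rw [hr1 (n + 1)]
      exact ((hhH i _).trans (hH i (not_le.1 hc).le)).trans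
        (hqm.trans ((hqQ m).trans (hQ hn'.le)))
    exact absurd (hN hle) (by omega)

/-- Partial functions with infinite domains can be guessed by one total function if the sequences of
their finite restrictions can. -/
theorem exists_guess_of_infinite {ι V : Type} [Inhabited V] (X : ι → Set ℕ)
    (hX : ∀ i, (X i).Infinite) (s : ι → ℕ → V)
    (hguess : ∀ f : ι → ℕ → Finset (ℕ × V), ∃ g : ℕ → Finset (ℕ × V), ∀ i, ∃ n, f i n = g n) :
    ∃ y : ℕ → V, ∀ i, ∃ m ∈ X i, y m = s i m := by
  classical
  choose A hA hcard using fun i (n : ℕ) => (hX i).exists_subset_card_eq (n + 1)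
  obtain ⟨g, hg⟩ := hguess fun i n => (A i n).image fun m => (m, s i m)
  let D (n : ℕ) : Finset ℕ :=
    if n + 1 ≤ ((g n).image Prod.fst).card then (g n).image Prod.fst else Finset.range (n + 1)
  have hD : ∀ n, n + 1 ≤ (D n).card := fun n => by
    dsimp only [D]
    split_ifs with h
    · exact h
    · exact (Finset.card_range _).ge
  -- Hall's theorem picks distinct points from the guessed domains, since the `n`th has at least `n
  -- + 1` elements; hence the guesses made at these points cannot conflict.
  obtain ⟨j, hj, hjD⟩ := (Finset.all_card_le_biUnion_card_iff_exists_injective D).1 fun t => by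
    rcases t.eq_empty_or_nonempty with rfl | ht
    · simp
    have hmax := t.max'_mem ht
    have h1 : t ⊆ Finset.range (t.max' ht + 1) := fun k hk =>
      Finset.mem_range.2 (Nat.lt_succ_of_le (t.le_max' k hk))
    have h2 := Finset.card_le_card h1
    rw [Finset.card_range] at h2
    exact h2.trans ((hD _).trans (Finset.card_le_card (Finset.subset_biUnion_of_mem D hmax)))
  refine ⟨fun m => if h : ∃ v n, j n = m ∧ (m, v) ∈ g n then h.choose else default, fun i => ?_⟩
  obtain ⟨n, hn⟩ := hg i
  have himg : (g n).image Prod.fst = A i n := by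
    rw [← hn, Finset.image_image]
    exact Finset.image_id
  have hDA : D n = A i n := by
    simp only [D, himg, hcard, le_refl, if_true]
  have hjA : j n ∈ A i n := hDA ▸ hjD n
  refine ⟨j n, hA i n hjA, ?_⟩
  have hex : ∃ v n', j n' = j n ∧ (j n, v) ∈ g n' :=
    ⟨s i (j n), n, rfl, hn ▸ Finset.mem_image_of_mem (fun m => (m, s i m)) hjA⟩
  change (if h : ∃ v n', j n' = j n ∧ (j n, v) ∈ g n' then h.choose else default) = _
  rw [dif_pos hex]
  obtain ⟨n', hn', hmem⟩ := hex.choose_spec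
  obtain rfl := hj hn'
  rw [← hn] at hmem
  obtain ⟨m, -, hm⟩ := Finset.mem_image.1 hmem
  obtain ⟨rfl, h2⟩ := Prod.mk.inj hm
  exact h2.symm

theorem exists_notMem_of_guess (hd : AlephOneLtDominating) {ι : Type} (hι : #ι ≤ ℵ₁)
    (hguess : ∀ f : ι → ℕ → Finset (ℕ × (ℕ →₀ ℕ)), ∃ g : ℕ → Finset (ℕ × (ℕ →₀ ℕ)),
      ∀ i, ∃ n, f i n = g n)
    (M : ι → Set (ℕ → ℕ)) (hM : ∀ i, IsClosed (M i)) (hM' : ∀ i, IsNowhereDense (M i)) :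
    ∃ x, ∀ i, x ∉ M i := by
  choose N s hRN hsN hs using fun i => exists_avoiding_block (hM i) (hM' i)
  obtain ⟨r, hr, hr0, hX⟩ := hd.exists_strictMono hι N
  obtain ⟨y, hy⟩ := exists_guess_of_infinite (V := ℕ →₀ ℕ) _ hX (fun i n => s i (r n)) hguess
  choose b hb hb' using hr.exists_mem_Ico_succ hr0
  have hbu : ∀ k n, r n ≤ k → k < r (n + 1) → b k = n := fun k n h h' => by
    have h1 := hr.lt_iff_lt.1 ((hb k).trans_lt h')
    have h2 := hr.lt_iff_lt.1 (h.trans_lt (hb' k))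
    omega
  -- The truncation keeps all values before `r n` at most `r n`, yet leaves a correctly guessed
  -- block intact because its values are bounded by `N i (r n) ≤ r (n + 1)`.
  refine ⟨fun k => min (y (b k) k) (r (b k + 1)), fun i => ?_⟩
  obtain ⟨n, hn, hyn⟩ := hy i
  refine hs i (r n) _ (fun k hk => (min_le_right _ _).trans (hr.monotone ?_)) fun k hk hkN => ?_
  · exact hr.lt_iff_lt.1 ((hb k).trans_lt hk)
  · have hn' : N i (r n) ≤ r (n + 1) := hn
    rw [hbu k n hk (hkN.trans_le hn'), hyn]
    exact min_eq_left ((hsN i (r n) k).trans hn')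

/-! ### The main theorem -/

theorem exists_nowhereDense_cover (h : covM = ℵ₁) : ∃ (T : Type) (M : T → Set (ℕ → ℕ)),
    #T ≤ ℵ₁ ∧ (∀ i, IsClosed (M i)) ∧ (∀ i, IsNowhereDense (M i)) ∧ ∀ x, ∃ i, x ∈ M i := by
  have hne : {κ | ∃ F : Set (Set (ℕ → ℕ)), (∀ M ∈ F, IsMeagre M) ∧ ⋃₀ F = univ ∧
      #F = κ}.Nonempty := by
    by_contra hne
    rw [not_nonempty_iff_eq_empty] at hne
    rw [covM, hne, Cardinal.sInf_empty] at h
    exact (Cardinal.aleph_pos 1).ne h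
  obtain ⟨F, hF, hcover, hcard⟩ := csInf_mem hne
  change #F = covM at hcard
  have hmeagre : ∀ M : F, ∃ A : Set (Set (ℕ → ℕ)), (∀ t ∈ A, IsNowhereDense t) ∧ A.Countable ∧
      (M : Set (ℕ → ℕ)) ⊆ ⋃₀ A := fun M =>
    isMeagre_iff_countable_union_isNowhereDense.1 (hF M M.2)
  choose A hA hAc hMA using hmeagre
  refine ⟨Σ M : F, A M, fun p => closure p.2, ?_, fun _ => isClosed_closure,
    fun p => (hA p.1 _ p.2.2).closure, fun x => ?_⟩
  · rw [Cardinal.mk_sigma]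
    refine (Cardinal.sum_le_sum _ (fun _ => ℵ₀) fun M => (hAc M).le_aleph0).trans ?_
    rw [Cardinal.sum_const, Cardinal.lift_id, Cardinal.lift_id, hcard, h]
    exact Cardinal.mul_le_of_le (Cardinal.aleph0_le_aleph 1) le_rfl (Cardinal.aleph0_le_aleph 1)
  · have hx : x ∈ ⋃₀ F := hcover ▸ mem_univ x
    obtain ⟨M, hM, hxM⟩ := hx
    obtain ⟨t, ht, hxt⟩ := hMA ⟨M, hM⟩ hxM
    exact ⟨⟨⟨M, hM⟩, ⟨t, ht⟩⟩, subset_closure hxt⟩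

/-- If `cov(ℳ) = ℵ₁ < 𝔡`, then some `ℵ₁` many functions cannot be guessed at even one point by a
single function. -/
theorem exists_eventuallyDifferent (hd : AlephOneLtDominating) (h : covM = ℵ₁) {ι : Type}
    (hι : #ι = ℵ₁) : ∃ f : ι → ℕ → ℕ → ℕ → ℕ, ∀ g : ℕ → ℕ → ℕ → ℕ, ∃ i, ∀ n k l,
      f i n k l ≠ g n k l := by
  obtain ⟨T, M, hT, hM, hM', hcover⟩ := exists_nowhereDense_cover h
  by_contra! hcon
  obtain ⟨e⟩ : Nonempty (T ↪ ι) := (Cardinal.le_def T ι).1 (hι ▸ hT)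
  obtain ⟨c⟩ : Nonempty (Finset (ℕ × (ℕ →₀ ℕ)) ≃ ℕ) := by
    rw [← Cardinal.eq, Cardinal.mk_nat]
    exact Cardinal.mk_eq_aleph0 _
  obtain ⟨x, hx⟩ := exists_notMem_of_guess hd hT (fun f => by
    obtain ⟨g, hg⟩ := hcon fun i n k l =>
      Function.extend e (fun t => c (f t (Nat.pair n (Nat.pair k l)))) 0 i
    refine ⟨fun m => c.symm (g m.unpair.1 m.unpair.2.unpair.1 m.unpair.2.unpair.2), fun t => ?_⟩
    obtain ⟨n, k, l, hnkl⟩ := hg (e t)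
    rw [e.injective.extend_apply] at hnkl
    refine ⟨Nat.pair n (Nat.pair k l), ?_⟩
    simp [← hnkl]) M hM hM'
  obtain ⟨i, hi⟩ := hcover x
  exact hx i hi

end ODiag

theorem mainTheorem6 (h : ODiag.covM = Cardinal.aleph 1) : ODiag.od = Cardinal.aleph 1 := by
  by_cases hd : ODiag.AlephOneLtDominating
  · let ι := (Cardinal.aleph 1).ord.ToType
    have hι : #ι = Cardinal.aleph 1 := Cardinal.mk_ord_toType _
    have hcount : ∀ j : ι, (Iio j).Countable := fun j => by
      rw [← Cardinal.le_aleph0_iff_set_countable, ← Order.lt_succ_iff, Cardinal.succ_aleph0]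
      exact (Cardinal.mk_Iio_lt j (by simp [ι])).trans_eq hι
    obtain ⟨f, hf⟩ := ODiag.exists_eventuallyDifferent hd h hι
    exact ODiag.od_eq_aleph_one_of_eventuallyDifferent hd hι.le hcount f hf
  · exact ODiag.od_eq_aleph_one_of_dominating hd
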